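/- Let $d\ge 1$, $\mathbb T^d=(\mathbb R/2\pi\mathbb Z)^d$, and let $V:\mathbb T^d\to\mathbb R$ be continuous, with $\mathrm{Ker}(-\Delta+V)=0$ in $L^2(\mathbb T^d)$. Then $L^2(\mathbb T^d)$ has a Hilbert basis of eigenfunctions of $-\Delta+V$, whose eigenvalues, counted with multiplicity and listed in non-decreasing order, tend to $+\infty$: $$\mu_1\le\dots\le\mu_{n^-}<0<\mu_{n^-+1}\le\dots,$$ where $n^-\ge 0$ is the number of negative eigenvalues. Let $\beta_0:=\min\{|\mu_{n^-}|/2,\ \mu_{n^-+1}\}$, to be read as $\beta_0:=\mu_1$ when $n^-=0$. For a finite non-empty set $B\subset\mathbb Z^d$, let $\Pi_B$ be the $L^2$-orthogonal projector onto $E_B:=\mathrm{span}\{e^{\mathrm i j\cdot x}: j\in B\}$, and let $(-\Delta+V)_B:=\Pi_B(-\Delta+V)_{|E_B}$. Let $|j|:=\max_k|j_k|$, with associated distance $\mathrm d$ on $\mathbb Z^d$, let $\partial B:=\{j\in B:\ \mathrm d(j,\mathbb Z^d\setminus B)=1\}$ and $\mathtt B(0,r):=\{j\in\mathbb Z^d: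 |j|\le r\}$. Then there is $L_0\in\mathbb N$ (depending only on $d$ and $V$) such that, for every finite non-empty $B\subset\mathbb Z^d$ with $\mathrm d(0,\partial B)\ge L_0$: 1. if $\mathtt B(0,L_0-1)\subset\mathbb Z^d\setminus B$, then $(-\Delta+V)_B\ge\beta_0 I$; 2. if $\mathtt B(0,L_0)\subset B$, then, counting multiplicity, $(-\Delta+V)_B$ has exactly $n^-$ negative eigenvalues, all of them $\le-\beta_0$, and all its other eigenvalues are $\ge\beta_0$. -/

import Mathlib

open MeasureTheory Filter
open scoped ENNReal Real

noncomputable section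

namespace TorusSpectral

instance instFactTwoPiPos : Fact (0 < 2 * π) := ⟨Real.two_pi_pos⟩

/-- The torus `𝕋ᵈ = (ℝ / 2πℤ)ᵈ`. -/
abbrev Torus (d : ℕ) : Type := Fin d → AddCircle (2 * π)

/-- Lebesgue measure on the torus divided by `(2π)ᵈ`, so that the torus has total mass one. -/
def torusMeasure (d : ℕ) : Measure (Torus d) :=
  Measure.pi fun _ => AddCircle.haarAddCircle

instance instProbTorus (d : ℕ) : IsProbabilityMeasure (torusMeasure d) := by
  unfold torusMeasure; infer_instance

/-- The complex space `L²(𝕋ᵈ)`. -/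
abbrev L2 (d : ℕ) : Type := Lp ℂ 2 (torusMeasure d)

/-- The exponential `x ↦ exp(i j·x)` as a continuous function on the torus. -/
def expFun {d : ℕ} (j : Fin d → ℤ) : C(Torus d, ℂ) where
  toFun x := ∏ k, fourier (j k) (x k)
  continuous_toFun := by fun_prop

theorem expFun_coe {d : ℕ} (j : Fin d → ℤ) (x : Fin d → ℝ) :
    expFun j (fun k => (x k : AddCircle (2 * π)))
      = Complex.exp (Complex.I * ∑ k, (j k : ℂ) * (x k : ℂ)) := by
  simp only [expFun, ContinuousMap.coe_mk, fourier_coe_apply, Finset.mul_sum, Complex.exp_sum]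
  refine Finset.prod_congr rfl fun k _ => ?_
  congr 1
  have : (π : ℂ) ≠ 0 := by exact_mod_cast Real.pi_ne_zero
  push_cast
  field_simp

/-- The exponential `e_j`, `e_j(x) = exp(i j·x)`, as an element of `L²(𝕋ᵈ)`. -/
def expL2 {d : ℕ} (j : Fin d → ℤ) : L2 d :=
  ContinuousMap.toLp (E := ℂ) 2 (torusMeasure d) ℂ (expFun j)

/-- The Fourier coefficient `û(j) = (2π)⁻ᵈ ∫ u(x) exp(-i j·x) dx`. -/
def fourierCoef {d : ℕ} (u : L2 d) (j : Fin d → ℤ) : ℂ := inner ℂ (expL2 j) u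

/-- The squared Euclidean length `j₁² + … + j_d²` of a frequency. -/
def freqSq {d : ℕ} (j : Fin d → ℤ) : ℝ := ∑ k, (j k : ℝ) ^ 2

/-- `u` belongs to the domain `H²(𝕋ᵈ)` of the Laplacian, and `-Δu = f ∈ L²(𝕋ᵈ)`. -/
def IsNegLaplacian {d : ℕ} (u f : L2 d) : Prop :=
  ∀ j : Fin d → ℤ, fourierCoef f j = (freqSq j : ℂ) * fourierCoef u j

theorem memLp_potential_mul {d : ℕ} (V : C(Torus d, ℝ)) (u : L2 d) :
    MemLp (fun x => (V x : ℂ) * u x) 2 (torusMeasure d) := by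
  have hc : Continuous fun x => (V x : ℂ) := Complex.continuous_ofReal.comp V.continuous
  refine MemLp.of_le_mul (c := ‖V‖) (Lp.memLp u)
    (hc.aestronglyMeasurable.mul (Lp.aestronglyMeasurable u)) (Eventually.of_forall fun x => ?_)
  rw [norm_mul, Complex.norm_real]
  exact mul_le_mul_of_nonneg_right (V.norm_coe_le_norm x) (norm_nonneg _)

/-- Multiplication by the potential `V` on `L²(𝕋ᵈ)`. -/
def potentialMul {d : ℕ} (V : C(Torus d, ℝ)) : L2 d →ₗ[ℂ] L2 d where
  toFun u := (memLp_potential_mul V u).toLp _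
  map_add' u v := by
    ext1
    filter_upwards [(memLp_potential_mul V (u + v)).coeFn_toLp,
      (memLp_potential_mul V u).coeFn_toLp, (memLp_potential_mul V v).coeFn_toLp,
      Lp.coeFn_add u v, Lp.coeFn_add ((memLp_potential_mul V u).toLp _)
        ((memLp_potential_mul V v).toLp _)] with x h1 h2 h3 h4 h5
    rw [h1, h5, Pi.add_apply, h2, h3, h4, Pi.add_apply, mul_add]
  map_smul' c u := by
    ext1
    filter_upwards [(memLp_potential_mul V (c • u)).coeFn_toLp,
      (memLp_potential_mul V u).coeFn_toLp, Lp.coeFn_smul c u,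
      Lp.coeFn_smul c ((memLp_potential_mul V u).toLp _)] with x h1 h2 h3 h4
    simp only [RingHom.id_apply]
    rw [h1, h4, Pi.smul_apply, h2, h3, Pi.smul_apply, smul_eq_mul, smul_eq_mul]
    ring

/-- `u` is in `H²(𝕋ᵈ)` and `(-Δ + V) u = lam u`. -/
def SolvesEigenEq {d : ℕ} (V : C(Torus d, ℝ)) (lam : ℝ) (u : L2 d) : Prop :=
  IsNegLaplacian u ((lam : ℂ) • u - potentialMul V u)

/-- `Ker(-Δ + V) = 0`. -/
def TrivialKernel {d : ℕ} (V : C(Torus d, ℝ)) : Prop :=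
  ∀ u : L2 d, SolvesEigenEq V 0 u → u = 0

/-- `mu 0 ≤ mu 1 ≤ …` is the list of the eigenvalues of `-Δ + V` in non-decreasing order, each
repeated according to its multiplicity: they tend to `+∞`, and corresponding eigenfunctions form
a Hilbert basis of `L²(𝕋ᵈ)`. The list starts at index `0`: the `p`-th eigenvalue is
`mu (p - 1)`. -/
structure IsEigenvalueList {d : ℕ} (V : C(Torus d, ℝ)) (mu : ℕ → ℝ) : Prop where
  monotone : Monotone mu
  tendsto : Tendsto mu atTop atTop
  exists_basis : ∃ ψ : HilbertBasis ℕ ℂ (L2 d), ∀ p, SolvesEigenEq V (mu p) (ψ p)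

/-- The number of negative terms of the list `mu`. -/
def numNeg (mu : ℕ → ℝ) : ℕ := {p : ℕ | mu p < 0}.ncard

/-- With `n = numNeg mu`, the minimum of half the modulus of the largest negative eigenvalue
`mu (n - 1)` and of the smallest positive eigenvalue `mu n`. If there is no negative eigenvalue,
it is `mu 0`. -/
def beta0 (mu : ℕ → ℝ) : ℝ :=
  if numNeg mu = 0 then mu 0
  else min (|mu (numNeg mu - 1)| / 2) (mu (numNeg mu))

/-- The space `E_B` spanned by the exponentials `e_j`, `j ∈ B`. -/
def E {d : ℕ} (B : Finset (Fin d → ℤ)) : Submodule ℂ (L2 d) :=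
  Submodule.span ℂ (expL2 '' (B : Set (Fin d → ℤ)))

instance instFiniteE {d : ℕ} (B : Finset (Fin d → ℤ)) : FiniteDimensional ℂ (E B) :=
  FiniteDimensional.span_of_finite ℂ (B.finite_toSet.image _)

/-- The map `u ↦ ∑_{j ∈ B} |j|² û(j) e_j`, which is `-Δ` on `E_B`
(see `isNegLaplacian_negLapOn`). -/
def negLapOn {d : ℕ} (B : Finset (Fin d → ℤ)) : L2 d →ₗ[ℂ] L2 d where
  toFun u := ∑ j ∈ B, ((freqSq j : ℂ) * fourierCoef u j) • expL2 j
  map_add' u v := by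
    simp only [fourierCoef, inner_add_right, mul_add, add_smul, Finset.sum_add_distrib]
  map_smul' c u := by
    simp only [fourierCoef, inner_smul_right, Finset.smul_sum, smul_smul, RingHom.id_apply]
    refine Finset.sum_congr rfl fun j _ => ?_
    ring_nf

theorem orthonormal_expL2 {d : ℕ} : Orthonormal ℂ (expL2 (d := d)) := by
  rw [orthonormal_iff_ite]
  intro m n
  have h1 : inner ℂ (expL2 m) (expL2 n)
      = ∏ k, inner ℂ (fourierLp (T := 2 * π) 2 (m k)) (fourierLp (T := 2 * π) 2 (n k)) := by
    rw [expL2, expL2, ContinuousMap.inner_toLp]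
    simp only [fourierLp, ContinuousMap.inner_toLp, expFun, ContinuousMap.coe_mk, map_prod,
      ← Finset.prod_mul_distrib]
    exact integral_fintype_prod_eq_prod (𝕜 := ℂ)
      (fun k (x : AddCircle (2 * π)) => fourier (n k) x * (starRingEnd ℂ) (fourier (m k) x))
  rw [h1]
  have h2 := orthonormal_iff_ite.mp (orthonormal_fourier (T := 2 * π))
  simp only [h2]
  by_cases h : m = n
  · subst h; simp
  · obtain ⟨k, hk⟩ := Function.ne_iff.mp h
    rw [if_neg h]
    exact Finset.prod_eq_zero (Finset.mem_univ k) (if_neg hk)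

theorem isNegLaplacian_negLapOn {d : ℕ} (B : Finset (Fin d → ℤ)) (u : L2 d) (hu : u ∈ E B) :
    IsNegLaplacian u (negLapOn B u) := by
  classical
  intro j
  have ho := orthonormal_iff_ite.mp (orthonormal_expL2 (d := d))
  have h1 : fourierCoef (negLapOn B u) j
      = if j ∈ B then (freqSq j : ℂ) * fourierCoef u j else 0 := by
    have hd : negLapOn B u = ∑ i ∈ B, ((freqSq i : ℂ) * fourierCoef u i) • expL2 i := rfl
    rw [hd]
    conv_lhs => unfold fourierCoef
    rw [inner_sum]
    simp only [inner_smul_right, ho]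
    simp only [mul_ite, mul_one, mul_zero, Finset.sum_ite_eq]
    rfl
  rw [h1]
  split_ifs with hj
  · rfl
  · suffices h : fourierCoef u j = 0 by rw [h, mul_zero]
    clear h1
    unfold E at hu
    induction hu using Submodule.span_induction with
    | mem x hx =>
      obtain ⟨i, hi, rfl⟩ := hx
      have hne : j ≠ i := fun h => hj (h ▸ hi)
      simp [fourierCoef, ho, hne]
    | zero => simp [fourierCoef]
    | add x y _ _ hx hy =>
      simp only [fourierCoef, inner_add_right] at *
      rw [hx, hy, add_zero]
    | smul c x _ hx =>
      simp only [fourierCoef, inner_smul_right] at *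
      rw [hx, mul_zero]

/-- The restricted operator `(-Δ + V)_B = Π_B (-Δ + V)|_{E_B}`, where `Π_B` is the orthogonal
projector onto `E_B`. -/
def truncOp {d : ℕ} (V : C(Torus d, ℝ)) (B : Finset (Fin d → ℤ)) : E B →ₗ[ℂ] E B :=
  ((E B).orthogonalProjectionOnto : L2 d →ₗ[ℂ] E B) ∘ₗ (negLapOn B + potentialMul V) ∘ₗ (E B).subtype

theorem truncOp_isSymmetric {d : ℕ} (V : C(Torus d, ℝ)) (B : Finset (Fin d → ℤ)) :
    (truncOp V B).IsSymmetric := by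
  have hL : (negLapOn B).IsSymmetric := by
    intro u v
    simp only [negLapOn, LinearMap.coe_mk, AddHom.coe_mk, sum_inner, inner_sum, inner_smul_left,
      inner_smul_right, fourierCoef, map_mul, Complex.conj_ofReal, inner_conj_symm]
    refine Finset.sum_congr rfl fun j _ => ?_
    ring
  have hV : (potentialMul V).IsSymmetric := by
    intro u v
    rw [L2.inner_def, L2.inner_def]
    refine integral_congr_ae ?_
    filter_upwards [(memLp_potential_mul V u).coeFn_toLp, (memLp_potential_mul V v).coeFn_toLp]
      with x h1 h2
    change inner ℂ (((memLp_potential_mul V u).toLp _ : L2 d) x) (v x)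
      = inner ℂ (u x) (((memLp_potential_mul V v).toLp _ : L2 d) x)
    rw [h1, h2]
    simp only [RCLike.inner_apply, map_mul, Complex.conj_ofReal]
    ring
  intro u v
  have h := (hL.add hV) (u : L2 d) (v : L2 d)
  have h1 : inner ℂ (truncOp V B u) v
      = inner ℂ ((negLapOn B + potentialMul V) (u : L2 d)) (v : L2 d) :=
    Submodule.inner_orthogonalProjectionOnto_eq_of_mem_right v _
  have h2 : inner ℂ u (truncOp V B v)
      = inner ℂ (u : L2 d) ((negLapOn B + potentialMul V) (v : L2 d)) :=
    Submodule.inner_orthogonalProjectionOnto_eq_of_mem_left u _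
  rw [h1, h2, h]

/-- The eigenvalues of `(-Δ + V)_B`, each repeated according to its multiplicity. -/
def truncEigenvalues {d : ℕ} (V : C(Torus d, ℝ)) (B : Finset (Fin d → ℤ)) :
    Fin (Module.finrank ℂ (E B)) → ℝ :=
  (truncOp_isSymmetric V B).eigenvalues rfl

/-- The inner boundary `∂B` of `B`: the points of `B` at distance one from the complement of `B`,
for the sup-distance (the standard distance on `Fin d → ℤ`). -/
def innerBoundary {d : ℕ} (B : Finset (Fin d → ℤ)) : Set (Fin d → ℤ) :=
  {j | j ∈ B ∧ Metric.infDist j {k | k ∉ B} = 1}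

/-- The ball `{j : |j| ≤ r}` of `ℤᵈ` for the sup-norm. -/
def supBall (d : ℕ) (r : ℤ) : Set (Fin d → ℤ) := {j | ∀ k, |j k| ≤ r}

end TorusSpectral

end

/-! Existence of the eigenvalues: for `c = ‖V‖ + 1`, the operator `-Δ + V + c` is inverted by a
Neumann series around the Fourier multiplier `1 / (|j|² + c)`, which is compact because its entries
tend to zero. The inverse is compact, symmetric and injective, so the spectral theorem yields an
eigenbasis. Only finitely many eigenvalues lie below any level (`card_le_of_eigenvalue_le`), so they
can be sorted.

The rest compares quadratic forms: on `E B` the form of `truncOp V B` is that of `-Δ + V`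
(`inner_truncOp`). If `B` avoids a large ball, the kinetic energy dominates the potential
(`truncOp_sub_isPositive`). If `B` contains a large ball, two dimension counts squeeze the spectrum.
At most `numNeg mu` truncated eigenvalues are below `beta0 mu` (`card_truncEigenvalues_lt_le`). At
least `numNeg mu` are at most `-beta0 mu` (`eventually_le_card_truncEigenvalues_le`): Fourier
truncation of the eigenfunctions does not increase the kinetic energy and barely changes the
potential energy, and the factor 1/2 in `beta0` leaves room for the error. Hence the index sets for
`≤ -beta0 mu`, `< 0` and `< beta0 mu` coincide, which gives the count and the gap at once. -/

noncomputable section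

namespace TorusSpectral

/-! ### Parseval and diagonal operators in a Hilbert basis -/

section HilbertBasisLemmas

variable {ι H : Type*} [NormedAddCommGroup H] [InnerProductSpace ℂ H]

theorem hasSum_norm_sq_inner (b : HilbertBasis ι ℂ H) (u : H) :
    HasSum (fun i => ‖inner ℂ (b i) u‖ ^ 2) (‖u‖ ^ 2) := by
  have h := Complex.hasSum_re (b.hasSum_inner_mul_inner u u)
  have h1 : (inner ℂ u u).re = ‖u‖ ^ 2 := by
    rw [inner_self_eq_norm_sq_to_K]; norm_cast
  rw [h1] at h
  refine h.congr_fun fun i => ?_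
  rw [← inner_conj_symm u (b i), ← Complex.normSq_eq_conj_mul_self, Complex.ofReal_re,
    Complex.normSq_eq_norm_sq]

theorem norm_le_mul_of_inner_le (b : HilbertBasis ι ℂ H) {u v : H} {C : ℝ} (hC : 0 ≤ C)
    (h : ∀ i, ‖inner ℂ (b i) v‖ ≤ C * ‖inner ℂ (b i) u‖) : ‖v‖ ≤ C * ‖u‖ := by
  refine le_of_sq_le_sq ?_ (by positivity)
  rw [mul_pow]
  refine hasSum_le (fun i => ?_) (hasSum_norm_sq_inner b v)
    ((hasSum_norm_sq_inner b u).mul_left (C ^ 2))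
  rw [← mul_pow]
  exact pow_le_pow_left₀ (norm_nonneg _) (h i) 2

theorem eq_of_inner_basis_eq (b : HilbertBasis ι ℂ H) {u v : H}
    (h : ∀ i, inner ℂ (b i) u = inner ℂ (b i) v) : u = v := by
  apply b.repr.injective
  ext i
  simpa only [HilbertBasis.repr_apply_apply] using h i

/-- Existence of the diagonal operator with bounded entries in a Hilbert basis. -/
theorem exists_diagonalOperator (b : HilbertBasis ι ℂ H) (a : ι → ℂ) {C : ℝ} (hC : 0 ≤ C)
    (ha : ∀ i, ‖a i‖ ≤ C) :
    ∃ T : H →L[ℂ] H, (∀ u i, inner ℂ (b i) (T u) = a i * inner ℂ (b i) u) ∧ ‖T‖ ≤ C := by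
  have hmem : ∀ u : H, Memℓp (fun i => a i * b.repr u i) 2 := fun u =>
    memℓp_gen (by
      have hs := (hasSum_norm_sq_inner b u).summable.mul_left (C ^ 2)
      refine hs.of_nonneg_of_le (fun i => by positivity) fun i => ?_
      rw [b.repr_apply_apply, ENNReal.toReal_ofNat, Real.rpow_two, norm_mul, mul_pow]
      exact mul_le_mul_of_nonneg_right (pow_le_pow_left₀ (norm_nonneg _) (ha i) 2)
        (by positivity))
  let f : H → H := fun u => b.repr.symm ⟨fun i => a i * b.repr u i, hmem u⟩
  have hf : ∀ u i, inner ℂ (b i) (f u) = a i * inner ℂ (b i) u := fun u i => by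
    rw [← b.repr_apply_apply, ← b.repr_apply_apply]
    simp [f]
  let L : H →ₗ[ℂ] H :=
    { toFun := f
      map_add' := fun u v => eq_of_inner_basis_eq b fun i => by
        simp only [inner_add_right, hf, mul_add]
      map_smul' := fun c u => eq_of_inner_basis_eq b fun i => by
        simp only [inner_smul_right, hf, RingHom.id_apply]; ring }
  refine ⟨L.mkContinuous C fun u => norm_le_mul_of_inner_le b hC fun i => ?_, hf,
    LinearMap.mkContinuous_norm_le _ hC _⟩
  change ‖inner ℂ (b i) (f u)‖ ≤ _
  rw [hf, norm_mul]
  exact mul_le_mul_of_nonneg_right (ha i) (norm_nonneg _)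

/-- A diagonal operator whose entries tend to zero is compact. -/
theorem isCompactOperator_of_diagonal [CompleteSpace H] (b : HilbertBasis ι ℂ H) {a : ι → ℂ}
    {T : H →L[ℂ] H} (hT : ∀ u i, inner ℂ (b i) (T u) = a i * inner ℂ (b i) u)
    (ha : ∀ ε > 0, {i | ε < ‖a i‖}.Finite) : IsCompactOperator T := by
  classical
  -- Finite-rank truncations of `T`; outside the finitely many large entries the remainder is small
  -- in operator norm.
  let F : Finset ι → H →L[ℂ] H := fun s =>
    ∑ i ∈ s, (ContinuousLinearMap.toSpanSingleton ℂ (a i • b i)).comp (innerSL ℂ (b i))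
  have hF : ∀ s u i, inner ℂ (b i) (F s u) = if i ∈ s then a i * inner ℂ (b i) u else 0 := by
    intro s u i
    have ho := orthonormal_iff_ite.mp b.orthonormal
    simp only [F, sum_apply, ContinuousLinearMap.comp_apply,
      ContinuousLinearMap.toSpanSingleton_apply, inner_sum, inner_smul_right, ho,
      innerSL_apply_apply]
    simp only [mul_ite, mul_one, mul_zero, Finset.sum_ite_eq]
    split_ifs
    · ring
    · rfl
  refine isCompactOperator_of_tendsto (l := atTop) (F := F) ?_ (Eventually.of_forall fun s => ?_)
  · rw [Metric.tendsto_atTop]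
    intro ε hε
    refine ⟨(ha (ε / 2) (by positivity)).toFinset, fun s hs => ?_⟩
    rw [dist_eq_norm]
    refine lt_of_le_of_lt (ContinuousLinearMap.opNorm_le_bound _ (half_pos hε).le fun u => ?_)
      (half_lt_self hε)
    refine norm_le_mul_of_inner_le b (half_pos hε).le fun i => ?_
    rw [sub_apply, inner_sub_right, hF, hT]
    split_ifs with hi
    · rw [sub_self, norm_zero]; positivity
    · rw [zero_sub, norm_neg, norm_mul]
      refine mul_le_mul_of_nonneg_right ?_ (norm_nonneg _)
      by_contra hlt
      exact hi (hs (by simpa using hlt))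
  · refine Submodule.sum_mem (compactOperator (RingHom.id ℂ) H H) fun i _ => ?_
    have h : IsCompactOperator (ContinuousLinearMap.toSpanSingleton ℂ (a i • b i)) :=
      isCompactOperator_of_locallyCompactSpace_rng _
    exact h.comp_clm (innerSL ℂ (b i))

end HilbertBasisLemmas

/-! ### Sorting a family with finite sublevel sets -/

section Sorting

/-- A real family with finite sublevel sets on an infinite type can be listed in non-decreasing
order. -/
theorem exists_equiv_monotone {ι : Type*} [Infinite ι] (f : ι → ℝ)
    (hf : ∀ C, {i | f i ≤ C}.Finite) : ∃ e : ℕ ≃ ι, Monotone (f ∘ e) := by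
  have hc : Countable ι := by
    rw [← Set.countable_univ_iff]
    refine (Set.countable_iUnion fun n : ℕ => (hf n).countable).mono fun i _ => ?_
    obtain ⟨n, hn⟩ := exists_nat_ge (f i)
    exact Set.mem_iUnion.mpr ⟨n, hn⟩
  obtain ⟨g, hg⟩ := exists_injective_nat ι
  -- The injection `g` breaks ties between equal values of `f`, so the lexicographic order pulls
  -- back to a linear order.
  let key : ι → Lex (ℝ × ℕ) := fun i => toLex (f i, g i)
  have hkey : Function.Injective key := fun i j h => by
    have := congrArg (fun x => (ofLex x).2) h
    exact hg this
  let : LinearOrder ι := LinearOrder.lift' key hkey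
  have hle : ∀ i j : ι, i ≤ j → f i ≤ f j := fun i j h => by
    have h' : key i ≤ key j := h
    rw [Prod.Lex.le_iff] at h'
    rcases h' with h' | h'
    · exact h'.le
    · exact h'.1.le
  -- An infinite linear order with finite initial segments is isomorphic to `ℕ`.
  have hIic : ∀ i : ι, (Set.Iic i).Finite := fun i => (hf (f i)).subset fun j hj => hle j i hj
  let : LocallyFiniteOrder ι :=
    LocallyFiniteOrder.ofFiniteIcc fun a b => (hIic b).subset Set.Icc_subset_Iic_self
  let := LinearLocallyFiniteOrder.succOrder ι
  let := LinearLocallyFiniteOrder.predOrder ι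
  have : NoMaxOrder ι := ⟨fun a => by
    obtain ⟨b, hb⟩ := (hIic a).exists_notMem
    exact ⟨b, not_le.mp hb⟩⟩
  obtain ⟨i₀⟩ := (inferInstance : Nonempty ι)
  obtain ⟨m, hm⟩ := (hIic i₀).exists_minimal ⟨i₀, Set.mem_Iic.mpr le_rfl⟩
  let : OrderBot ι :=
    { bot := m
      bot_le := fun a => by
        rcases le_total m a with h | h
        · exact h
        · exact hm.2 (h.trans hm.1) h }
  let e : ι ≃o ℕ := orderIsoNatOfLinearSuccPredArch
  exact ⟨e.symm.toEquiv, fun a b hab => hle _ _ (e.symm.monotone hab)⟩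

end Sorting

/-! ### Dimension counts and quadratic forms in orthonormal coordinates -/

section LinearAlgebra

/-- A homogeneous linear system with fewer equations than unknowns has a nonzero solution. -/
theorem exists_ne_zero_sum_mul_eq_zero {ι κ : Type*} [Fintype ι] [Fintype κ]
    (h : Fintype.card κ < Fintype.card ι) (a : κ → ι → ℂ) :
    ∃ c : ι → ℂ, c ≠ 0 ∧ ∀ k, ∑ i, c i * a k i = 0 := by
  let M : Matrix κ ι ℂ := Matrix.of a
  have hk := LinearMap.ker_ne_bot_of_finrank_lt (f := M.mulVecLin) (by simpa using h)
  obtain ⟨c, hc, hc0⟩ := Submodule.exists_mem_ne_zero_of_ne_bot hk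
  refine ⟨c, hc0, fun k => ?_⟩
  have := congrFun (LinearMap.mem_ker.mp hc) k
  simpa [M, Matrix.mulVec, dotProduct, mul_comm] using this

variable {ι H : Type*} [Fintype ι] [NormedAddCommGroup H] [InnerProductSpace ℂ H]

theorem norm_sq_sum_smul {v : ι → H} (hv : Orthonormal ℂ v) (c : ι → ℂ) :
    ‖∑ i, c i • v i‖ ^ 2 = ∑ i, ‖c i‖ ^ 2 := by
  have h := hv.inner_sum c c Finset.univ
  rw [← inner_self_eq_norm_sq (𝕜 := ℂ), h, map_sum]
  refine Finset.sum_congr rfl fun i _ => ?_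
  rw [← Complex.normSq_eq_conj_mul_self, Complex.normSq_eq_norm_sq]
  exact Complex.ofReal_re _

/-- The second sum is the image of the first under an operator with eigenpairs `(lam i, v i)`. Not
naming the operator lets this serve both `-Δ + V` and its truncations. -/
theorem re_inner_sum_smul {v : ι → H} (hv : Orthonormal ℂ v) (lam : ι → ℝ) (c : ι → ℂ) :
    (inner ℂ (∑ i, c i • v i) (∑ i, ((lam i : ℂ) * c i) • v i)).re
      = ∑ i, lam i * ‖c i‖ ^ 2 := by
  rw [hv.inner_sum, Complex.re_sum]
  refine Finset.sum_congr rfl fun i _ => ?_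
  rw [mul_left_comm, ← Complex.normSq_eq_conj_mul_self, Complex.normSq_eq_norm_sq]
  norm_cast

theorem re_inner_sum_smul_le {v : ι → H} (hv : Orthonormal ℂ v) {lam : ι → ℝ} {C : ℝ}
    (h : ∀ i, lam i ≤ C) (c : ι → ℂ) :
    (inner ℂ (∑ i, c i • v i) (∑ i, ((lam i : ℂ) * c i) • v i)).re
      ≤ C * ‖∑ i, c i • v i‖ ^ 2 := by
  rw [re_inner_sum_smul hv, norm_sq_sum_smul hv, Finset.mul_sum]
  exact Finset.sum_le_sum fun i _ => mul_le_mul_of_nonneg_right (h i) (by positivity)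

theorem re_inner_sum_smul_lt {v : ι → H} (hv : Orthonormal ℂ v) {lam : ι → ℝ} {C : ℝ}
    (h : ∀ i, lam i < C) {c : ι → ℂ} (hc : c ≠ 0) :
    (inner ℂ (∑ i, c i • v i) (∑ i, ((lam i : ℂ) * c i) • v i)).re
      < C * ‖∑ i, c i • v i‖ ^ 2 := by
  rw [re_inner_sum_smul hv, norm_sq_sum_smul hv, Finset.mul_sum]
  obtain ⟨i, hi⟩ := Function.ne_iff.mp hc
  refine Finset.sum_lt_sum (fun i _ => mul_le_mul_of_nonneg_right (h i).le (by positivity))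
    ⟨i, Finset.mem_univ i, mul_lt_mul_of_pos_right (h i) ?_⟩
  have : 0 < ‖c i‖ := norm_pos_iff.mpr hi
  positivity

theorem norm_sum_smul_pos {v : ι → H} (hv : Orthonormal ℂ v) {c : ι → ℂ} (hc : c ≠ 0) :
    0 < ‖∑ i, c i • v i‖ := by
  rw [norm_pos_iff]
  intro h0
  exact hc (funext fun i => linearIndependent_iff'.mp hv.linearIndependent _ c h0 i
    (Finset.mem_univ i))

end LinearAlgebra

/-! ### The exponentials as a Hilbert basis -/

section FourierBasis

variable {d : ℕ}

/-- Stone–Weierstrass: products and conjugates of exponentials are exponentials, so their span is a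
star subalgebra, and the coordinate exponentials separate points. -/
theorem span_expFun_closure_eq_top :
    (Submodule.span ℂ (Set.range (expFun (d := d)))).topologicalClosure = ⊤ := by
  classical
  let A : StarSubalgebra ℂ C(Torus d, ℂ) :=
    { toSubalgebra := Algebra.adjoin ℂ (Set.range expFun)
      star_mem' := by
        change Algebra.adjoin ℂ (Set.range expFun) ≤ star (Algebra.adjoin ℂ (Set.range expFun))
        refine Algebra.adjoin_le ?_
        rintro _ ⟨n, rfl⟩
        refine Algebra.subset_adjoin ⟨-n, ?_⟩
        ext1 x
        simp [expFun] }
  have hA : A.toSubalgebra.toSubmodule = Submodule.span ℂ (Set.range (expFun (d := d))) := by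
    apply Algebra.adjoin_eq_span_of_subset
    refine .trans (fun x => Submonoid.closure_induction (fun _ => id) ⟨0, ?_⟩ ?_)
      Submodule.subset_span
    · ext z
      simp [expFun]
    · rintro _ _ _ _ ⟨m, rfl⟩ ⟨n, rfl⟩
      refine ⟨m + n, ?_⟩
      ext z
      simp [expFun, fourier_add', Finset.prod_mul_distrib]
  have hsep : A.SeparatesPoints := by
    intro x y hxy
    obtain ⟨i, hi⟩ := Function.ne_iff.mp hxy
    have hs : ∀ z : Torus d, expFun (Pi.single i 1) z = fourier 1 (z i) := fun z => by
      simp only [expFun, ContinuousMap.coe_mk]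
      rw [Finset.prod_eq_single i]
      · simp
      · intro j _ hj
        simp [Pi.single_eq_of_ne hj]
      · simp
    refine ⟨_, ⟨expFun (Pi.single i 1), Algebra.subset_adjoin ⟨Pi.single i 1, rfl⟩, rfl⟩, ?_⟩
    change expFun _ x ≠ expFun _ y
    rw [hs, hs, fourier_one, fourier_one]
    exact fun h => hi (AddCircle.injective_toCircle Real.two_pi_pos.ne' (Circle.ext h))
  rw [← hA]
  exact congr_arg (Subalgebra.toSubmodule <| StarSubalgebra.toSubalgebra ·)
    (ContinuousMap.starSubalgebra_topologicalClosure_eq_top_of_separatesPoints A hsep)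

theorem span_expL2_closure_eq_top :
    (Submodule.span ℂ (Set.range (expL2 (d := d)))).topologicalClosure = ⊤ := by
  have h := (ContinuousMap.toLp_denseRange (p := 2) ℂ (torusMeasure d) ℂ
    (by simp)).topologicalClosure_map_submodule span_expFun_closure_eq_top
  rw [Submodule.map_span, ← Set.range_comp] at h
  exact h

/-- The exponentials as a Hilbert basis of `L²(𝕋ᵈ)`. -/
def fourierBasis (d : ℕ) : HilbertBasis (Fin d → ℤ) ℂ (L2 d) :=
  HilbertBasis.mk orthonormal_expL2 span_expL2_closure_eq_top.ge

theorem fourierBasis_apply (j : Fin d → ℤ) : fourierBasis d j = expL2 j := by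
  rw [fourierBasis, HilbertBasis.coe_mk]

theorem inner_fourierBasis (j : Fin d → ℤ) (u : L2 d) :
    inner ℂ (fourierBasis d j) u = fourierCoef u j := by
  rw [fourierBasis_apply, fourierCoef]

theorem hasSum_norm_sq_fourierCoef (u : L2 d) :
    HasSum (fun j => ‖fourierCoef u j‖ ^ 2) (‖u‖ ^ 2) := by
  simpa only [inner_fourierBasis] using hasSum_norm_sq_inner (fourierBasis d) u

theorem hasSum_fourierCoef_inner (u v : L2 d) :
    HasSum (fun j => (starRingEnd ℂ) (fourierCoef u j) * fourierCoef v j) (inner ℂ u v) := by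
  refine ((fourierBasis d).hasSum_inner_mul_inner u v).congr_fun fun j => ?_
  rw [inner_fourierBasis, ← inner_conj_symm u, inner_fourierBasis]

theorem hasSum_fourierCoef_smul (u : L2 d) :
    HasSum (fun j => fourierCoef u j • expL2 j) u := by
  refine ((fourierBasis d).hasSum_repr u).congr_fun fun j => ?_
  rw [HilbertBasis.repr_apply_apply, inner_fourierBasis, fourierBasis_apply]

theorem freqSq_nonneg (j : Fin d → ℤ) : 0 ≤ freqSq j :=
  Finset.sum_nonneg fun _ _ => sq_nonneg _

theorem abs_le_of_freqSq_le {j : Fin d → ℤ} {n : ℕ} (h : freqSq j ≤ (n : ℝ) ^ 2) (k : Fin d) :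
    |j k| ≤ n := by
  have h1 : ((j k : ℝ)) ^ 2 ≤ (n : ℝ) ^ 2 :=
    (Finset.single_le_sum (f := fun k => (j k : ℝ) ^ 2) (fun _ _ => sq_nonneg _)
      (Finset.mem_univ k)).trans h
  have h2 := abs_le_of_sq_le_sq h1 (by positivity)
  exact_mod_cast h2

theorem finite_supBall (r : ℤ) : (supBall d r).Finite := by
  refine (Set.finite_Icc (fun _ : Fin d => -r) fun _ => r).subset fun j hj => ?_
  exact ⟨fun k => (abs_le.mp (hj k)).1, fun k => (abs_le.mp (hj k)).2⟩

theorem finite_freqSq_le (C : ℝ) : {j : Fin d → ℤ | freqSq j ≤ C}.Finite := by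
  obtain ⟨n, hn⟩ := exists_nat_ge (max C 1)
  have hC : C ≤ (n : ℝ) ^ 2 := by
    have h1 : C ≤ n := (le_max_left _ _).trans hn
    have h2 : (1 : ℝ) ≤ n := (le_max_right _ _).trans hn
    nlinarith
  exact (finite_supBall (n : ℤ)).subset fun j hj k =>
    abs_le_of_freqSq_le (le_trans hj hC) k

end FourierBasis

/-! ### The operator `-Δ + V` and its eigenbasis -/

section Schrodinger

variable {d : ℕ} {V : C(Torus d, ℝ)}

theorem coeFn_potentialMul (V : C(Torus d, ℝ)) (u : L2 d) :
    potentialMul V u =ᵐ[torusMeasure d] fun x => (V x : ℂ) * u x :=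
  (memLp_potential_mul V u).coeFn_toLp

theorem norm_potentialMul_le (V : C(Torus d, ℝ)) (u : L2 d) :
    ‖potentialMul V u‖ ≤ ‖V‖ * ‖u‖ := by
  refine Lp.norm_le_mul_norm_of_ae_le_mul ?_
  filter_upwards [coeFn_potentialMul V u] with x hx
  rw [hx, norm_mul, Complex.norm_real]
  exact mul_le_mul_of_nonneg_right (V.norm_coe_le_norm x) (norm_nonneg _)

theorem potentialMul_isSymmetric (V : C(Torus d, ℝ)) : (potentialMul V).IsSymmetric := by
  intro u v
  rw [L2.inner_def, L2.inner_def]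
  refine integral_congr_ae ?_
  filter_upwards [coeFn_potentialMul V u, coeFn_potentialMul V v] with x h1 h2
  rw [h1, h2]
  simp only [RCLike.inner_apply, map_mul, Complex.conj_ofReal]
  ring

theorem abs_re_inner_potentialMul_le (V : C(Torus d, ℝ)) (u v : L2 d) :
    |(inner ℂ u (potentialMul V v)).re| ≤ ‖V‖ * ‖u‖ * ‖v‖ := by
  refine (Complex.abs_re_le_norm _).trans ((norm_inner_le_norm _ _).trans ?_)
  calc ‖u‖ * ‖potentialMul V v‖ ≤ ‖u‖ * (‖V‖ * ‖v‖) :=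
        mul_le_mul_of_nonneg_left (norm_potentialMul_le V v) (norm_nonneg _)
    _ = ‖V‖ * ‖u‖ * ‖v‖ := by ring

theorem fourierCoef_add (u v : L2 d) (j : Fin d → ℤ) :
    fourierCoef (u + v) j = fourierCoef u j + fourierCoef v j := inner_add_right _ _ _

theorem fourierCoef_sub (u v : L2 d) (j : Fin d → ℤ) :
    fourierCoef (u - v) j = fourierCoef u j - fourierCoef v j := inner_sub_right _ _ _

theorem fourierCoef_smul (c : ℂ) (u : L2 d) (j : Fin d → ℤ) :
    fourierCoef (c • u) j = c * fourierCoef u j := inner_smul_right _ _ _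

/-- `u` is in `H²(𝕋ᵈ)` and `(-Δ + V) u = f`. -/
def IsSchrodinger (V : C(Torus d, ℝ)) (u f : L2 d) : Prop :=
  IsNegLaplacian u (f - potentialMul V u)

theorem IsSchrodinger.add {u f v g : L2 d} (hu : IsSchrodinger V u f)
    (hv : IsSchrodinger V v g) : IsSchrodinger V (u + v) (f + g) := by
  intro j
  have h1 := hu j
  have h2 := hv j
  simp only [map_add, fourierCoef_add, fourierCoef_sub] at *
  linear_combination h1 + h2

theorem IsSchrodinger.smul {u f : L2 d} (hu : IsSchrodinger V u f) (c : ℂ) :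
    IsSchrodinger V (c • u) (c • f) := by
  intro j
  have h1 := hu j
  simp only [map_smul, fourierCoef_smul, fourierCoef_sub] at *
  linear_combination c * h1

theorem isSchrodinger_zero : IsSchrodinger V 0 0 := by
  intro j
  simp [fourierCoef]

theorem isSchrodinger_sum {ι : Type*} (s : Finset ι) {u f : ι → L2 d}
    (h : ∀ i ∈ s, IsSchrodinger V (u i) (f i)) :
    IsSchrodinger V (∑ i ∈ s, u i) (∑ i ∈ s, f i) := by
  classical
  induction s using Finset.induction_on with
  | empty => simpa using isSchrodinger_zero
  | insert a s ha ih =>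
    rw [Finset.sum_insert ha, Finset.sum_insert ha]
    exact (h a (Finset.mem_insert_self a s)).add
      (ih fun i hi => h i (Finset.mem_insert_of_mem hi))

/-- The Parseval series agree term by term because `freqSq j` is real; this replaces integration by
parts. -/
theorem IsNegLaplacian.inner_eq {u f v g : L2 d} (hu : IsNegLaplacian u f)
    (hv : IsNegLaplacian v g) : inner ℂ f v = inner ℂ u g := by
  refine (hasSum_fourierCoef_inner f v).unique
    ((hasSum_fourierCoef_inner u g).congr_fun fun j => ?_)
  rw [hu j, hv j, map_mul, Complex.conj_ofReal]
  ring

theorem IsSchrodinger.inner_eq {u f v g : L2 d} (hu : IsSchrodinger V u f)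
    (hv : IsSchrodinger V v g) : inner ℂ f v = inner ℂ u g := by
  have h := IsNegLaplacian.inner_eq hu hv
  rw [inner_sub_left, inner_sub_right, potentialMul_isSymmetric V u v] at h
  exact sub_left_injective h

theorem IsNegLaplacian.hasSum_re_inner {u f : L2 d} (h : IsNegLaplacian u f) :
    HasSum (fun j => freqSq j * ‖fourierCoef u j‖ ^ 2) (inner ℂ u f).re := by
  refine (Complex.hasSum_re (hasSum_fourierCoef_inner u f)).congr_fun fun j => ?_
  rw [h j, mul_left_comm, ← Complex.normSq_eq_conj_mul_self, Complex.normSq_eq_norm_sq,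
    ← Complex.ofReal_mul, Complex.ofReal_re]

/-- The kinetic energy is at least `R ‖u‖²` and the potential costs at most `‖V‖ ‖u‖²`. -/
theorem IsSchrodinger.mul_norm_sq_le {u f : L2 d} (h : IsSchrodinger V u f) {R : ℝ}
    (hR : ∀ j, fourierCoef u j ≠ 0 → R ≤ freqSq j) :
    (R - ‖V‖) * ‖u‖ ^ 2 ≤ (inner ℂ u f).re := by
  have h1 : R * ‖u‖ ^ 2 ≤ (inner ℂ u (f - potentialMul V u)).re := by
    refine hasSum_le (fun j => ?_) ((hasSum_norm_sq_fourierCoef u).mul_left R)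
      (IsNegLaplacian.hasSum_re_inner h)
    by_cases hj : fourierCoef u j = 0
    · simp [hj]
    · exact mul_le_mul_of_nonneg_right (hR j hj) (by positivity)
  have h2 := (abs_le.mp (abs_re_inner_potentialMul_le V u u)).1
  rw [inner_sub_right, Complex.sub_re] at h1
  nlinarith

/-- An orthonormal family of eigenfunctions with eigenvalues at most `C` has at most as many
elements as there are frequencies with `|j|² ≤ C + ‖V‖`. -/
theorem card_le_of_eigenvalue_le {ι : Type*} [Fintype ι] {v : ι → L2 d}
    (hv : Orthonormal ℂ v) {lam : ι → ℝ} (h : ∀ i, SolvesEigenEq V (lam i) (v i)) {C : ℝ}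
    (hC : ∀ i, lam i ≤ C) :
    Fintype.card ι ≤ (finite_freqSq_le (d := d) (C + ‖V‖)).toFinset.card := by
  by_contra! hlt
  set F := (finite_freqSq_le (d := d) (C + ‖V‖)).toFinset with hF
  -- With more vectors than frequencies in `F`, some nonzero combination has no Fourier coefficient
  -- in `F`.
  obtain ⟨c, hc, h0⟩ := exists_ne_zero_sum_mul_eq_zero (κ := F) (by simpa using hlt)
    fun j i => fourierCoef (v i) j
  set u := ∑ i, c i • v i with hu
  have hcoef : ∀ j ∈ F, fourierCoef u j = 0 := fun j hj => by
    rw [← h0 ⟨j, hj⟩, hu, fourierCoef, inner_sum]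
    simp only [inner_smul_right, fourierCoef]
  have hS : IsSchrodinger V u (∑ i, ((lam i : ℂ) * c i) • v i) :=
    isSchrodinger_sum _ fun i _ => by
      have := IsSchrodinger.smul (V := V) (h i) (c i)
      rwa [smul_smul, mul_comm (c i)] at this
  have hup := re_inner_sum_smul_le hv hC c
  -- The upper bound `C ‖u‖²` is not strict, so a strict gap above `C + ‖V‖` is needed. It exists
  -- because only finitely many frequencies lie in the window of length one above that level.
  obtain ⟨R, hR, hRF⟩ : ∃ R, C + ‖V‖ < R ∧ ∀ j : Fin d → ℤ, j ∉ F → R ≤ freqSq j := by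
    have hfin := finite_freqSq_le (d := d) (C + ‖V‖ + 1)
    by_cases hne : ({j : Fin d → ℤ | freqSq j ≤ C + ‖V‖ + 1} \ F).Nonempty
    · obtain ⟨m, hm, hmin⟩ := (hfin.subset Set.sdiff_subset).exists_minimalFor freqSq _ hne
      have hm2 : C + ‖V‖ < freqSq m := by simpa [hF] using hm.2
      refine ⟨freqSq m, hm2, fun j hj => ?_⟩
      rcases le_total (freqSq j) (freqSq m) with hle | hle
      · exact hmin ⟨hle.trans hm.1, hj⟩ hle
      · exact hle
    · refine ⟨C + ‖V‖ + 1, by linarith, fun j hj => ?_⟩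
      by_contra! hlt'
      exact hne ⟨j, hlt'.le, hj⟩
  have hlow := hS.mul_norm_sq_le (R := R) fun j hj => hRF j fun hjF => hj (hcoef j hjF)
  have hpos := norm_sum_smul_pos hv hc
  have : 0 < ‖u‖ ^ 2 := by positivity
  nlinarith

/-- A compact symmetric injective resolvent of `-Δ + V`. -/
theorem exists_resolvent (V : C(Torus d, ℝ)) :
    ∃ (c : ℝ) (T : L2 d →L[ℂ] L2 d), IsCompactOperator T ∧
      ∀ f, IsSchrodinger V (T f) (f - (c : ℂ) • T f) := by
  -- With `R = (-Δ + c)⁻¹` and `W` multiplication by `V`, this gives `‖R W‖ ≤ ‖V‖ / c < 1`.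
  set c : ℝ := ‖V‖ + 1 with hc
  have hc0 : 0 < c := by positivity
  have hpos : ∀ j : Fin d → ℤ, 0 < freqSq j + c := fun j => add_pos_of_nonneg_of_pos
    (freqSq_nonneg j) hc0
  have hnorm : ∀ j : Fin d → ℤ, ‖((freqSq j + c : ℝ) : ℂ)⁻¹‖ = (freqSq j + c)⁻¹ := fun j => by
    rw [norm_inv, Complex.norm_real, Real.norm_of_nonneg (hpos j).le]
  obtain ⟨R, hR, hRnorm⟩ := exists_diagonalOperator (fourierBasis d)
    (fun j => ((freqSq j + c : ℝ) : ℂ)⁻¹) (C := c⁻¹) (by positivity) fun j => by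
      rw [hnorm]
      exact inv_anti₀ hc0 (le_add_of_nonneg_left (freqSq_nonneg j))
  have hRcomp : IsCompactOperator R := by
    refine isCompactOperator_of_diagonal _ hR fun ε hε => ?_
    refine (finite_freqSq_le (d := d) (ε⁻¹)).subset fun j hj => ?_
    rw [Set.mem_ofPred_eq, hnorm] at hj
    have := (lt_inv_comm₀ hε (hpos j)).mp hj
    exact le_trans (le_add_of_nonneg_right hc0.le) this.le
  let W : L2 d →L[ℂ] L2 d := (potentialMul V).mkContinuous ‖V‖ (norm_potentialMul_le V)
  have hW : ‖W‖ ≤ ‖V‖ := LinearMap.mkContinuous_norm_le _ (norm_nonneg _) _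
  have hlt : ‖-(R * W)‖ < 1 := by
    rw [norm_neg]
    calc ‖R * W‖ ≤ ‖R‖ * ‖W‖ := norm_mul_le _ _
      _ ≤ c⁻¹ * ‖V‖ := mul_le_mul hRnorm hW (norm_nonneg _) (by positivity)
      _ < 1 := by rw [inv_mul_lt_one₀ hc0]; linarith
  -- `U = 1 + R W`. Since `-Δ + V + c = (-Δ + c) U`, the resolvent is `U⁻¹ R`, compact because `R`
  -- is.
  let U := Units.oneSub _ hlt
  refine ⟨c, (↑U⁻¹ : L2 d →L[ℂ] L2 d) * R, hRcomp.clm_comp _, fun f => ?_⟩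
  set u := ((↑U⁻¹ : L2 d →L[ℂ] L2 d) * R) f with hu
  have h1 : u + R (potentialMul V u) = R f := by
    have h2 : (U : L2 d →L[ℂ] L2 d) u = R f := by
      rw [hu, ← mul_apply_eq_comp, ← mul_assoc, Units.mul_inv, one_mul]
    rw [← h2]
    simp only [U, Units.val_oneSub, sub_neg_eq_add]
    rfl
  intro j
  have h3 := congrArg (fun w => fourierCoef w j) h1
  simp only [inner_fourierBasis] at hR
  rw [fourierCoef_add, hR, hR] at h3
  have hne : ((freqSq j + c : ℝ) : ℂ) ≠ 0 := by exact_mod_cast (hpos j).ne'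
  field_simp at h3
  push_cast at h3
  simp only [fourierCoef_sub, fourierCoef_smul]
  linear_combination -h3

/-- `L²(𝕋ᵈ)` has a Hilbert basis of eigenfunctions of `-Δ + V`. -/
theorem exists_eigenbasis (V : C(Torus d, ℝ)) :
    ∃ (ι : Type) (v : ι → L2 d) (lam : ι → ℝ), Orthonormal ℂ v ∧
      (Submodule.span ℂ (Set.range v))ᗮ = ⊥ ∧ ∀ i, SolvesEigenEq V (lam i) (v i) := by
  obtain ⟨c, T, hcomp, hT⟩ := exists_resolvent V
  have hsymm : (T : L2 d →ₗ[ℂ] L2 d).IsSymmetric := by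
    intro f g
    have h := (hT f).inner_eq (hT g)
    rw [inner_sub_left, inner_sub_right, inner_smul_left, inner_smul_right,
      Complex.conj_ofReal] at h
    exact (sub_left_injective h).symm
  -- Injectivity excludes the eigenvalue `0` of `T`, so that eigenvalues can be inverted below.
  have hinj : ∀ f, T f = 0 → f = 0 := fun f hf => by
    refine eq_of_inner_basis_eq (fourierBasis d) fun j => ?_
    have h := hT f j
    rw [hf] at h
    rw [inner_fourierBasis, inner_zero_right]
    simpa [fourierCoef] using h
  have hbot := ContinuousLinearMap.orthogonalComplement_iSup_eigenspaces_eq_bot hcomp hsymm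
  let G : ℂ → Submodule ℂ (L2 d) := fun τ => Module.End.eigenspace (T : L2 d →ₗ[ℂ] L2 d) τ
  have hclosed : ∀ τ, CompleteSpace (G τ) := fun τ => by
    have : IsClosed (G τ : Set (L2 d)) := by
      have : (G τ : Set (L2 d)) = {u | T u = τ • u} := by
        ext u
        exact Module.End.mem_eigenspace_iff
      rw [this]
      exact isClosed_eq T.continuous (continuous_const_smul τ)
    exact this.completeSpace_coe
  choose w b hb using fun τ => exists_hilbertBasis ℂ (G τ)
  have hortho := hsymm.orthogonalFamily_eigenspaces.orthonormal_sigma_orthonormal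
    (fun τ => (b τ).orthonormal)
  have hsp : (Submodule.span ℂ (Set.range fun a : Σ τ, w τ => ((b a.1 a.2 : G a.1) : L2 d)))ᗮ
      = ⊥ := by
    rw [Submodule.eq_bot_iff]
    intro u hu
    rw [Submodule.mem_orthogonal] at hu
    -- Each vector of `G τ` is a convergent series in the basis `b τ`, so the continuous functional
    -- `P` vanishes on it as soon as it vanishes on the basis.
    have : u ∈ (⨆ τ, G τ)ᗮ := by
      rw [← Submodule.iInf_orthogonal, Submodule.mem_iInf]
      intro τ
      rw [Submodule.mem_orthogonal']
      intro x hx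
      let P : G τ →L[ℂ] ℂ := (innerSL ℂ u).comp (G τ).subtypeL
      have hz : P ⟨x, hx⟩ = 0 := by
        have hs := ((b τ).hasSum_repr ⟨x, hx⟩).mapL P
        refine hs.unique (hasSum_zero.congr_fun fun i => ?_)
        rw [map_smul]
        have h0 := hu _ (Submodule.subset_span ⟨⟨τ, i⟩, rfl⟩)
        have h1 : P (b τ i) = 0 := inner_eq_zero_symm.mp h0
        rw [h1, smul_zero]
      exact hz
    rw [hbot] at this
    exact (Submodule.mem_bot ℂ).mp this
  -- From `T u = τ u` follows `(-Δ + V) u = (τ⁻¹ - c) u`; the symmetry of `T` makes `τ` real.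
  refine ⟨Σ τ, w τ, fun a => ((b a.1 a.2 : G a.1) : L2 d), fun a => (a.1⁻¹).re - c, hortho, hsp,
    fun a => ?_⟩
  obtain ⟨τ, i⟩ := a
  set u : L2 d := ((b τ i : G τ) : L2 d) with hu
  have hu0 : u ≠ 0 := (hortho.ne_zero (⟨τ, i⟩ : Σ τ, w τ))
  have hTu : T u = τ • u := Module.End.mem_eigenspace_iff.mp (b τ i : G τ).2
  have hτ : τ ≠ 0 := fun h => hu0 (hinj u (by rw [hTu, h, zero_smul]))
  have hconj : (starRingEnd ℂ) τ = τ :=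
    hsymm.conj_eigenvalue_eq_self (Module.End.hasEigenvalue_of_hasEigenvector
      ⟨(b τ i : G τ).2, hu0⟩)
  have hre : (((τ⁻¹).re : ℝ) : ℂ) = τ⁻¹ := by
    rw [← Complex.conj_eq_iff_re, map_inv₀, hconj]
  have h := (hT u).smul τ⁻¹
  rw [hTu, smul_sub, smul_smul, inv_mul_cancel₀ hτ, one_smul, smul_comm, smul_smul τ⁻¹,
    inv_mul_cancel₀ hτ, one_smul] at h
  change IsSchrodinger V u ((((τ⁻¹).re - c : ℝ) : ℂ) • u)
  rw [Complex.ofReal_sub, hre, sub_smul]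
  exact h

theorem exists_isEigenvalueList (hd : 1 ≤ d) (V : C(Torus d, ℝ)) :
    ∃ mu : ℕ → ℝ, IsEigenvalueList V mu := by
  obtain ⟨ι, v, lam, hv, hsp, heig⟩ := exists_eigenbasis V
  have hfin : ∀ C, {i | lam i ≤ C}.Finite := fun C => by
    by_contra hinf
    obtain ⟨t, ht, hcard⟩ := Set.Infinite.exists_subset_card_eq hinf
      ((finite_freqSq_le (d := d) (C + ‖V‖)).toFinset.card + 1)
    have := card_le_of_eigenvalue_le (ι := t) (hv.comp _ Subtype.val_injective)
      (fun i => heig i) (C := C) fun i => ht i.2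
    rw [Fintype.card_coe, hcard] at this
    omega
  have hinf : Infinite ι := by
    by_contra hni
    rw [not_infinite_iff_finite] at hni
    have : FiniteDimensional ℂ (Submodule.span ℂ (Set.range v)) :=
      FiniteDimensional.span_of_finite ℂ (Set.finite_range v)
    have htop : Submodule.span ℂ (Set.range v) = ⊤ := Submodule.orthogonal_eq_bot_iff.mp hsp
    rw [htop] at this
    have hfd : FiniteDimensional ℂ (L2 d) := Module.Finite.equiv Submodule.topEquiv
    -- For `d ≥ 1` there are infinitely many frequencies, so `L2 d` is infinite-dimensional; for `d
    -- = 0` it is one-dimensional and no infinite list exists.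
    have : Nonempty (Fin d) := ⟨⟨0, hd⟩⟩
    have := (orthonormal_expL2 (d := d)).linearIndependent.finite
    exact not_finite (Fin d → ℤ)
  obtain ⟨e, he⟩ := exists_equiv_monotone lam hfin
  refine ⟨lam ∘ e, he, tendsto_atTop_atTop_of_monotone he fun b => ?_,
    HilbertBasis.mkOfOrthogonalEqBot (v := v ∘ e) (hv.comp e e.injective) ?_, fun p => ?_⟩
  · by_contra! hlt
    exact Set.infinite_univ ((hfin b).preimage (f := e) e.injective.injOn |>.subset
      fun n _ => (hlt n).le)
  · rw [e.surjective.range_comp, hsp]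
  · rw [HilbertBasis.coe_mkOfOrthogonalEqBot]
    exact heig _

end Schrodinger

/-! ### Comparison of `-Δ + V` with its truncations -/

section Truncation

variable {d : ℕ} {V : C(Torus d, ℝ)}

/-- The orthogonal projector onto `E_B`, as a Fourier truncation. -/
def fourierProj (B : Finset (Fin d → ℤ)) : L2 d →ₗ[ℂ] L2 d where
  toFun u := ∑ j ∈ B, fourierCoef u j • expL2 j
  map_add' u v := by simp only [fourierCoef_add, add_smul, Finset.sum_add_distrib]
  map_smul' c u := by
    simp only [fourierCoef_smul, mul_smul, Finset.smul_sum, RingHom.id_apply]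

theorem fourierProj_apply (B : Finset (Fin d → ℤ)) (u : L2 d) :
    fourierProj B u = ∑ j ∈ B, fourierCoef u j • expL2 j := rfl

theorem fourierProj_mem (B : Finset (Fin d → ℤ)) (u : L2 d) : fourierProj B u ∈ E B :=
  Submodule.sum_mem _ fun j hj =>
    Submodule.smul_mem _ _ (Submodule.subset_span ⟨j, hj, rfl⟩)

open Classical in
theorem fourierCoef_fourierProj (B : Finset (Fin d → ℤ)) (u : L2 d) (j : Fin d → ℤ) :
    fourierCoef (fourierProj B u) j = if j ∈ B then fourierCoef u j else 0 := by
  have ho := orthonormal_iff_ite.mp (orthonormal_expL2 (d := d))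
  rw [fourierProj_apply]
  conv_lhs => unfold fourierCoef
  simp only [inner_sum, inner_smul_right, ho, mul_ite, mul_one, mul_zero, Finset.sum_ite_eq]
  rfl

theorem fourierCoef_eq_zero_of_mem_E {B : Finset (Fin d → ℤ)} {u : L2 d} (hu : u ∈ E B)
    {j : Fin d → ℤ} (hj : j ∉ B) : fourierCoef u j = 0 := by
  have hle : E B ≤ LinearMap.ker (innerₛₗ ℂ (expL2 j)) := by
    refine Submodule.span_le.mpr ?_
    rintro _ ⟨i, hi, rfl⟩
    exact orthonormal_expL2.2 fun h => hj (h ▸ hi)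
  exact LinearMap.mem_ker.mp (hle hu)

theorem norm_fourierProj_le (B : Finset (Fin d → ℤ)) (u : L2 d) :
    ‖fourierProj B u‖ ≤ ‖u‖ := by
  rw [← one_mul ‖u‖]
  refine norm_le_mul_of_inner_le (fourierBasis d) zero_le_one fun j => ?_
  rw [inner_fourierBasis, inner_fourierBasis, fourierCoef_fourierProj, one_mul]
  split_ifs
  · exact le_rfl
  · simp

theorem eventually_norm_sub_fourierProj_lt (u : L2 d) {ε : ℝ} (hε : 0 < ε) :
    ∀ᶠ L : ℕ in atTop, ∀ B : Finset (Fin d → ℤ), supBall d L ⊆ {j | j ∈ B} →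
      ‖u - fourierProj B u‖ < ε := by
  -- The Fourier series converges unconditionally, so the estimate holds for every finite `B`
  -- containing `F`, whatever its shape.
  obtain ⟨F, hF⟩ := Metric.tendsto_atTop.mp (hasSum_fourierCoef_smul u) ε hε
  obtain ⟨n, hn⟩ := exists_nat_ge (∑ j ∈ F, freqSq j)
  filter_upwards [eventually_ge_atTop (n + 1)] with L hL B hB
  rw [norm_sub_rev, ← dist_eq_norm]
  refine hF B fun j hj => hB fun k => abs_le_of_freqSq_le ?_ k
  have h1 : freqSq j ≤ n :=
    (Finset.single_le_sum (fun i _ => freqSq_nonneg i) hj).trans hn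
  have h2 : ((n : ℝ) + 1) ≤ L := by exact_mod_cast hL
  nlinarith [Nat.cast_nonneg (α := ℝ) n]

theorem isSchrodinger_of_mem_E (V : C(Torus d, ℝ)) {B : Finset (Fin d → ℤ)} {u : L2 d}
    (hu : u ∈ E B) : IsSchrodinger V u (negLapOn B u + potentialMul V u) := by
  unfold IsSchrodinger
  rw [add_sub_cancel_right]
  exact isNegLaplacian_negLapOn B u hu

/-- Paired with a vector of `E B`, the projector disappears. -/
theorem inner_truncOp (V : C(Torus d, ℝ)) (B : Finset (Fin d → ℤ)) (u : E B) :
    inner ℂ u (truncOp V B u)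
      = inner ℂ (u : L2 d) (negLapOn B (u : L2 d) + potentialMul V (u : L2 d)) :=
  Submodule.inner_orthogonalProjectionOnto_eq_of_mem_left u _

/-- Truncation discards nonnegative kinetic terms, and the potential term is continuous in `L²`.
Hence `L²`-smallness of `w - fourierProj B w` suffices, without any control of derivatives. -/
theorem re_inner_fourierProj_le (B : Finset (Fin d → ℤ)) {w f : L2 d}
    (h : IsSchrodinger V w f) :
    (inner ℂ (fourierProj B w)
        (negLapOn B (fourierProj B w) + potentialMul V (fourierProj B w))).re
      ≤ (inner ℂ w f).re + 2 * ‖V‖ * ‖w - fourierProj B w‖ * ‖w‖ := by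
  set x := fourierProj B w with hx
  have hlap : (inner ℂ x (negLapOn B x)).re ≤ (inner ℂ w (f - potentialMul V w)).re := by
    refine hasSum_le (fun j => ?_)
      (isNegLaplacian_negLapOn B x (fourierProj_mem B w)).hasSum_re_inner
      (IsNegLaplacian.hasSum_re_inner h)
    refine mul_le_mul_of_nonneg_left ?_ (freqSq_nonneg j)
    rw [hx, fourierCoef_fourierProj]
    split_ifs
    · exact le_rfl
    · rw [norm_zero, zero_pow two_ne_zero]; positivity
  have hpot : inner ℂ x (potentialMul V x) - inner ℂ w (potentialMul V w)
      = -inner ℂ (w - x) (potentialMul V x) - inner ℂ w (potentialMul V (w - x)) := by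
    rw [map_sub, inner_sub_left, inner_sub_right]
    ring
  have hpot' := congrArg Complex.re hpot
  simp only [Complex.sub_re, Complex.neg_re] at hpot'
  have h1 := (abs_le.mp (abs_re_inner_potentialMul_le V (w - x) x)).1
  have h2 := (abs_le.mp (abs_re_inner_potentialMul_le V w (w - x))).1
  have h3 : ‖V‖ * ‖w - x‖ * ‖x‖ ≤ ‖V‖ * ‖w - x‖ * ‖w‖ :=
    mul_le_mul_of_nonneg_left (norm_fourierProj_le B w) (by positivity)
  rw [inner_sub_right, Complex.sub_re] at hlap
  rw [inner_add_right, Complex.add_re]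
  nlinarith

theorem truncOp_sub_isPositive (V : C(Torus d, ℝ)) {B : Finset (Fin d → ℤ)} {β : ℝ}
    (h : ∀ j ∈ B, β + ‖V‖ ≤ freqSq j) :
    (truncOp V B - (β : ℂ) • LinearMap.id).IsPositive := by
  refine ⟨fun u v => ?_, fun u => ?_⟩
  · simp only [LinearMap.sub_apply, LinearMap.smul_apply, LinearMap.id_apply, inner_sub_left,
      inner_sub_right, inner_smul_left, inner_smul_right, Complex.conj_ofReal,
      truncOp_isSymmetric V B u v]
  · have h1 := (isSchrodinger_of_mem_E V u.2).mul_norm_sq_le (R := β + ‖V‖) fun j hj =>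
      h j (by_contra fun hjB => hj (fourierCoef_eq_zero_of_mem_E u.2 hjB))
    rw [← inner_truncOp, ← truncOp_isSymmetric V B u u] at h1
    have h2 : (inner ℂ ((β : ℂ) • u) u).re = β * ‖u‖ ^ 2 := by
      have h := congrArg Complex.re (inner_smul_left (𝕜 := ℂ) u u (β : ℂ))
      rw [Complex.conj_ofReal, Complex.re_ofReal_mul] at h
      exact h.trans (congrArg (β * ·) (inner_self_eq_norm_sq (𝕜 := ℂ) u))
    have h3 : ‖(u : L2 d)‖ = ‖u‖ := rfl
    rw [h3] at h1
    rw [LinearMap.sub_apply, LinearMap.smul_apply, LinearMap.id_apply, inner_sub_left, map_sub]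
    change 0 ≤ (inner ℂ (truncOp V B u) u).re - (inner ℂ ((β : ℂ) • u) u).re
    linarith

/-- The orthonormal basis of `E_B` diagonalizing `(-Δ + V)_B`. -/
def truncBasis (V : C(Torus d, ℝ)) (B : Finset (Fin d → ℤ)) :
    OrthonormalBasis (Fin (Module.finrank ℂ (E B))) ℂ (E B) :=
  (truncOp_isSymmetric V B).eigenvectorBasis rfl

theorem truncOp_truncBasis (V : C(Torus d, ℝ)) (B : Finset (Fin d → ℤ))
    (i : Fin (Module.finrank ℂ (E B))) :
    truncOp V B (truncBasis V B i) = (truncEigenvalues V B i : ℂ) • truncBasis V B i :=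
  (truncOp_isSymmetric V B).apply_eigenvectorBasis rfl i

theorem truncOp_sum_truncBasis (V : C(Torus d, ℝ)) (B : Finset (Fin d → ℤ)) {κ : Type*}
    [Fintype κ] (g : κ → Fin (Module.finrank ℂ (E B))) (c : κ → ℂ) :
    truncOp V B (∑ i, c i • truncBasis V B (g i))
      = ∑ i, ((truncEigenvalues V B (g i) : ℂ) * c i) • truncBasis V B (g i) := by
  rw [map_sum]
  refine Finset.sum_congr rfl fun i _ => ?_
  rw [map_smul, truncOp_truncBasis, smul_smul, mul_comm (c i)]

/-- At most `N` eigenvalues of `(-Δ + V)_B` are below the `N`-th eigenvalue of `-Δ + V`. -/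
theorem card_truncEigenvalues_lt_le {mu : ℕ → ℝ} {ψ : HilbertBasis ℕ ℂ (L2 d)}
    (hψ : ∀ p, SolvesEigenEq V (mu p) (ψ p)) {N : ℕ} {C : ℝ} (hC : ∀ p, N ≤ p → C ≤ mu p)
    (B : Finset (Fin d → ℤ)) :
    (Finset.univ.filter fun i => truncEigenvalues V B i < C).card ≤ N := by
  by_contra! hlt
  set s := Finset.univ.filter fun i => truncEigenvalues V B i < C with hs
  have ho : Orthonormal ℂ fun i : s => truncBasis V B i :=
    (truncBasis V B).orthonormal.comp _ Subtype.val_injective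
  -- More than `N` eigenvectors against `N` conditions: some nonzero `x` in their span is orthogonal
  -- to `ψ p` for all `p < N`. Its form is `< C ‖x‖²` in `truncBasis` but `≥ C ‖x‖²` in `ψ`.
  obtain ⟨c, hc, h0⟩ := exists_ne_zero_sum_mul_eq_zero (ι := s) (κ := Fin N) (by simpa using hlt)
    fun p i => inner ℂ (ψ p) ((truncBasis V B i : E B) : L2 d)
  set x : E B := ∑ i, c i • truncBasis V B i with hx
  have hup : (inner ℂ x (truncOp V B x)).re < C * ‖x‖ ^ 2 := by
    rw [hx, truncOp_sum_truncBasis]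
    exact re_inner_sum_smul_lt ho (lam := fun i : s => truncEigenvalues V B i)
      (fun i => (Finset.mem_filter.mp i.2).2) hc
  rw [inner_truncOp] at hup
  have hS := isSchrodinger_of_mem_E V x.2
  set f := negLapOn B (x : L2 d) + potentialMul V (x : L2 d)
  have horth : ∀ p < N, inner ℂ (ψ p) (x : L2 d) = 0 := fun p hp => by
    rw [← h0 ⟨p, hp⟩, hx, Submodule.coe_sum, inner_sum]
    simp only [Submodule.coe_smul, inner_smul_right]
  -- Symmetry moves the operator onto `ψ p`, so the form of `x` can be expanded in `ψ` by Parseval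
  -- alone.
  have hinner : ∀ p, inner ℂ (ψ p) f = (mu p : ℂ) * inner ℂ (ψ p) (x : L2 d) := fun p => by
    rw [← IsSchrodinger.inner_eq (hψ p) hS, inner_smul_left, Complex.conj_ofReal]
  have hsum := Complex.hasSum_re (ψ.hasSum_inner_mul_inner (x : L2 d) f)
  have hlow : C * ‖(x : L2 d)‖ ^ 2 ≤ (inner ℂ (x : L2 d) f).re := by
    refine hasSum_le (fun p => ?_) ((hasSum_norm_sq_inner ψ (x : L2 d)).mul_left C) hsum
    rw [hinner, ← inner_conj_symm _ (ψ p), mul_left_comm, ← Complex.normSq_eq_conj_mul_self,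
      Complex.normSq_eq_norm_sq, ← Complex.ofReal_mul, Complex.ofReal_re]
    rcases lt_or_ge p N with hp | hp
    · rw [horth p hp]; simp
    · exact mul_le_mul_of_nonneg_right (hC p hp) (by positivity)
  exact absurd hup (not_lt.mpr hlow)

theorem le_re_inner_truncOp (V : C(Torus d, ℝ)) (B : Finset (Fin d → ℤ)) {C : ℝ} (x : E B)
    (h : ∀ i, truncEigenvalues V B i ≤ C → inner ℂ (truncBasis V B i) x = 0) :
    C * ‖x‖ ^ 2 ≤ (inner ℂ x (truncOp V B x)).re := by
  have ho := (truncBasis V B).orthonormal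
  set c := fun i => inner ℂ (truncBasis V B i) x with hc
  have hx : x = ∑ i, c i • truncBasis V B i := ((truncBasis V B).sum_repr' x).symm
  have hT := truncOp_sum_truncBasis V B id c
  simp only [id_eq] at hT
  rw [hx, hT, re_inner_sum_smul ho, norm_sq_sum_smul ho,
    Finset.mul_sum]
  refine Finset.sum_le_sum fun i _ => ?_
  rcases le_or_gt (truncEigenvalues V B i) C with hi | hi
  · rw [show c i = 0 from h i hi]; simp
  · exact mul_le_mul_of_nonneg_right hi.le (by positivity)

/-- On `span (ψ p, p < N)` the defect of the truncation is controlled by its values on `ψ p`. -/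
theorem norm_sub_fourierProj_sum_le {N : ℕ} {v : Fin N → L2 d} (hv : Orthonormal ℂ v)
    (B : Finset (Fin d → ℤ)) {ε : ℝ} (h : ∀ p, ‖v p - fourierProj B (v p)‖ ≤ ε)
    (c : Fin N → ℂ) :
    ‖(∑ p, c p • v p) - fourierProj B (∑ p, c p • v p)‖ ≤ N * ε * ‖∑ p, c p • v p‖ := by
  have hc : ∀ p, ‖c p‖ ≤ ‖∑ p, c p • v p‖ := fun p => by
    refine le_of_sq_le_sq ?_ (norm_nonneg _)
    rw [norm_sq_sum_smul hv]
    exact Finset.single_le_sum (f := fun p => ‖c p‖ ^ 2) (fun _ _ => by positivity)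
      (Finset.mem_univ p)
  set w := ∑ p, c p • v p with hw
  have h1 : w - fourierProj B w = ∑ p, c p • (v p - fourierProj B (v p)) := by
    rw [hw, map_sum, ← Finset.sum_sub_distrib]
    simp only [map_smul, smul_sub]
  rw [h1]
  calc ‖∑ p, c p • (v p - fourierProj B (v p))‖
      ≤ ∑ p, ‖c p • (v p - fourierProj B (v p))‖ := norm_sum_le _ _
    _ ≤ ∑ _p : Fin N, ‖w‖ * ε := Finset.sum_le_sum fun p _ => by
        rw [norm_smul]
        exact mul_le_mul (hc p) (h p) (norm_nonneg _) (norm_nonneg _)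
    _ = N * ε * ‖w‖ := by
        rw [Finset.sum_const, Finset.card_univ, Fintype.card_fin, nsmul_eq_mul]; ring

/-- If the first `N` eigenvalues of `-Δ + V` are at most `-2β < 0`, then `(-Δ + V)_B` has at
least `N` eigenvalues below `-β` as soon as `B` contains a large ball. -/
theorem eventually_le_card_truncEigenvalues_le {mu : ℕ → ℝ} {ψ : HilbertBasis ℕ ℂ (L2 d)}
    (hψ : ∀ p, SolvesEigenEq V (mu p) (ψ p)) {N : ℕ} {β : ℝ} (hβ : 0 < β)
    (hmu : ∀ p < N, mu p ≤ -(2 * β)) :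
    ∀ᶠ L : ℕ in atTop, ∀ B : Finset (Fin d → ℤ), supBall d L ⊆ {j | j ∈ B} →
      N ≤ (Finset.univ.filter fun i => truncEigenvalues V B i ≤ -β).card := by
  -- Chosen so that the truncation error `2 ‖V‖ N ε` is below `β`; the `+ 1` covers `V = 0` and `N =
  -- 0`.
  set ε := β / (2 * ‖V‖ * N + 1) with hε
  have hden : 0 < 2 * ‖V‖ * N + 1 := by positivity
  have hε0 : 0 < ε := by positivity
  have hεβ : 2 * ‖V‖ * (N * ε) < β := by
    have h1 : ε * (2 * ‖V‖ * N + 1) = β := div_mul_cancel₀ _ hden.ne'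
    nlinarith
  have hev : ∀ᶠ L : ℕ in atTop, ∀ p : Fin N, ∀ B : Finset (Fin d → ℤ),
      supBall d L ⊆ {j | j ∈ B} → ‖ψ p - fourierProj B (ψ p)‖ < ε :=
    eventually_all.mpr fun p => eventually_norm_sub_fourierProj_lt (ψ p) hε0
  filter_upwards [hev] with L hL B hB
  by_contra! hlt
  set s := Finset.univ.filter fun i => truncEigenvalues V B i ≤ -β with hs
  have ho : Orthonormal ℂ fun p : Fin N => ψ p := ψ.orthonormal.comp _ Fin.val_injective
  -- If fewer than `N` eigenvalues are `≤ -β`, some nonzero `w` in the span of the `ψ p` has a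
  -- truncation orthogonal to all their eigenvectors, so its form is `≥ -β ‖fourierProj B w‖²`.
  obtain ⟨c, hc, h0⟩ := exists_ne_zero_sum_mul_eq_zero (ι := Fin N) (κ := s) (by simpa using hlt)
    fun i p => inner ℂ ((truncBasis V B i : E B) : L2 d) (fourierProj B (ψ p))
  have hdef := norm_sub_fourierProj_sum_le ho B (fun p => (hL p B hB).le) c
  have hS : IsSchrodinger V (∑ p : Fin N, c p • ψ p)
      (∑ p : Fin N, ((mu p : ℂ) * c p) • ψ p) :=
    isSchrodinger_sum _ fun p _ => by
      have := IsSchrodinger.smul (V := V) (hψ p) (c p)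
      rwa [smul_smul, mul_comm (c p)] at this
  have hQ := re_inner_sum_smul_le ho (lam := fun p : Fin N => mu p) (fun p => hmu p p.2) c
  have hpos := norm_sum_smul_pos ho hc
  set w := ∑ p : Fin N, c p • ψ p with hw
  have hup := re_inner_fourierProj_le B hS
  have hlow := le_re_inner_truncOp V B (C := -β) ⟨fourierProj B w, fourierProj_mem B w⟩
    fun i hi => by
      have hz : inner ℂ ((truncBasis V B i : E B) : L2 d) (fourierProj B w) = 0 := by
        rw [← h0 ⟨i, by simpa [hs] using hi⟩, hw, map_sum, inner_sum]
        simp only [map_smul, inner_smul_right]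
      exact hz
  rw [inner_truncOp] at hlow
  have hx : ‖(⟨fourierProj B w, fourierProj_mem B w⟩ : E B)‖ ≤ ‖w‖ := norm_fourierProj_le B w
  have hx2 := pow_le_pow_left₀ (norm_nonneg _) hx 2
  have h1 : 2 * ‖V‖ * ‖w - fourierProj B w‖ * ‖w‖ ≤ 2 * ‖V‖ * (N * ε) * ‖w‖ ^ 2 := by
    have := mul_le_mul_of_nonneg_left hdef (by positivity : 0 ≤ 2 * ‖V‖ * ‖w‖)
    nlinarith
  have h2 : 2 * ‖V‖ * (N * ε) * ‖w‖ ^ 2 < β * ‖w‖ ^ 2 :=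
    mul_lt_mul_of_pos_right hεβ (by positivity)
  -- As `-β < 0`, contraction gives `-β ‖w‖² ≤ -β ‖fourierProj B w‖²`; the truncation of `w` need
  -- not be shown nonzero.
  have h3 := mul_le_mul_of_nonneg_left hx2 hβ.le
  dsimp only at hlow
  linarith

end Truncation

/-! ### The index `numNeg` and the gap `beta0` -/

section EigenvalueList

variable {d : ℕ} {V : C(Torus d, ℝ)} {mu : ℕ → ℝ}

/-- By monotonicity the negative terms form an initial segment. It is finite since `mu` tends to
`+∞`, so `ncard` is not its default value `0` for infinite sets. -/
theorem neg_iff_lt_numNeg (hmono : Monotone mu) (ht : Tendsto mu atTop atTop) (p : ℕ) :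
    mu p < 0 ↔ p < numNeg mu := by
  classical
  have hex : ∃ n, 0 ≤ mu n := (ht.eventually_ge_atTop 0).exists
  have hiff : ∀ p, mu p < 0 ↔ p < Nat.find hex := fun p => by
    rw [Nat.lt_find_iff]
    exact ⟨fun h m hm => not_le.mpr ((hmono hm).trans_lt h), fun h => not_le.mp (h p le_rfl)⟩
  have hset : {p | mu p < 0} = ((Finset.range (Nat.find hex) : Finset ℕ) : Set ℕ) := by
    ext p
    rw [Finset.coe_range, Set.mem_Iio]
    exact hiff p
  rw [numNeg, hset, Set.ncard_coe_finset, Finset.card_range, hiff]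

theorem IsEigenvalueList.ne_zero (h : IsEigenvalueList V mu) (hker : TrivialKernel V) (p : ℕ) :
    mu p ≠ 0 := by
  obtain ⟨ψ, hψ⟩ := h.exists_basis
  intro h0
  have h1 := hψ p
  rw [h0] at h1
  exact ψ.orthonormal.ne_zero p (hker _ h1)

theorem IsEigenvalueList.pos_of_numNeg_le (h : IsEigenvalueList V mu) (hker : TrivialKernel V)
    {p : ℕ} (hp : numNeg mu ≤ p) : 0 < mu p :=
  lt_of_le_of_ne (not_lt.mp fun hlt => absurd ((neg_iff_lt_numNeg h.monotone h.tendsto p).mp hlt)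
    (not_lt.mpr hp)) (h.ne_zero hker p).symm

theorem beta0_le (mu : ℕ → ℝ) : beta0 mu ≤ mu (numNeg mu) := by
  unfold beta0
  split_ifs with h
  · rw [h]
  · exact min_le_right _ _

theorem IsEigenvalueList.beta0_pos (h : IsEigenvalueList V mu) (hker : TrivialKernel V) :
    0 < beta0 mu := by
  have h1 := h.pos_of_numNeg_le hker (le_refl (numNeg mu))
  unfold beta0
  split_ifs with h0
  · rwa [h0] at h1
  · have := abs_pos.mpr (h.ne_zero hker (numNeg mu - 1))
    exact lt_min (by positivity) h1

theorem IsEigenvalueList.le_neg_two_mul_beta0 (h : IsEigenvalueList V mu) {p : ℕ}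
    (hp : p < numNeg mu) : mu p ≤ -(2 * beta0 mu) := by
  have h0 : numNeg mu ≠ 0 := by omega
  have h1 : mu p ≤ mu (numNeg mu - 1) := h.monotone (by omega)
  have h2 : mu (numNeg mu - 1) < 0 :=
    (neg_iff_lt_numNeg h.monotone h.tendsto _).mpr (by omega)
  have h3 : beta0 mu ≤ |mu (numNeg mu - 1)| / 2 := by
    rw [beta0, if_neg h0]
    exact min_le_left _ _
  rw [abs_of_neg h2] at h3
  linarith

end EigenvalueList

end TorusSpectral

end

/-! ### Choice of `L₀` and conclusion -/

open TorusSpectral in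
theorem mainTheorem7 (d : ℕ) (hd : 1 ≤ d) (V : C(Torus d, ℝ)) (hker : TrivialKernel V) :
    (∃ mu : ℕ → ℝ, IsEigenvalueList V mu) ∧
    ∀ mu : ℕ → ℝ, IsEigenvalueList V mu →
      ∃ L₀ : ℕ, ∀ B : Finset (Fin d → ℤ), B.Nonempty →
        (L₀ : ℝ≥0∞) ≤ Metric.infEDist 0 (innerBoundary B) →
        (supBall d ((L₀ : ℤ) - 1) ⊆ {j | j ∉ B} →
          (truncOp V B - ((beta0 mu : ℝ) : ℂ) • LinearMap.id).IsPositive) ∧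
        (supBall d (L₀ : ℤ) ⊆ {j | j ∈ B} →
          {i | truncEigenvalues V B i < 0}.ncard = numNeg mu ∧
          (∀ i, truncEigenvalues V B i < 0 → truncEigenvalues V B i ≤ -beta0 mu) ∧
          (∀ i, ¬ truncEigenvalues V B i < 0 → beta0 mu ≤ truncEigenvalues V B i)) := by
  refine ⟨exists_isEigenvalueList hd V, fun mu hmu => ?_⟩
  have hβ := hmu.beta0_pos hker
  obtain ⟨ψ, hψ⟩ := hmu.exists_basis
  obtain ⟨n, hn⟩ := exists_nat_ge (beta0 mu + ‖V‖)
  -- `L₀ ≥ n + 1` serves the first claim: off the ball of radius `L₀ - 1` some coordinate has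
  -- modulus at least `n + 1`, whence `freqSq j ≥ (n + 1)² ≥ beta0 mu + ‖V‖`.
  obtain ⟨L₀, hcard, hL₀⟩ := ((eventually_le_card_truncEigenvalues_le hψ hβ
    fun p hp => hmu.le_neg_two_mul_beta0 hp).and (eventually_ge_atTop (n + 1))).exists
  refine ⟨L₀, fun B _ _ => ⟨fun hB => truncOp_sub_isPositive V fun j hj => ?_, fun hB => ?_⟩⟩
  · have hj' : j ∉ supBall d ((L₀ : ℤ) - 1) := fun h => hB h hj
    simp only [supBall, Set.mem_ofPred_eq, not_forall, not_le] at hj'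
    obtain ⟨k, hk⟩ := hj'
    have h1 : (n : ℤ) + 1 ≤ |j k| := by omega
    have h2 : (n : ℝ) + 1 ≤ |(j k : ℝ)| := by exact_mod_cast h1
    have h3 : (j k : ℝ) ^ 2 ≤ freqSq j :=
      Finset.single_le_sum (f := fun k => (j k : ℝ) ^ 2) (fun _ _ => sq_nonneg _)
        (Finset.mem_univ k)
    rw [← sq_abs] at h3
    nlinarith [Nat.cast_nonneg (α := ℝ) n]
  · have hge := hcard B hB
    have hle := card_truncEigenvalues_lt_le hψ (N := numNeg mu) (C := beta0 mu)
      (fun p hp => (beta0_le mu).trans (hmu.monotone hp)) B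
    have hs1 : (Finset.univ.filter fun i => truncEigenvalues V B i ≤ -beta0 mu) ⊆
        Finset.univ.filter fun i => truncEigenvalues V B i < 0 :=
      Finset.monotone_filter_right _ fun i _ hi => lt_of_le_of_lt hi (neg_lt_zero.mpr hβ)
    have hs2 : (Finset.univ.filter fun i => truncEigenvalues V B i < 0) ⊆
        Finset.univ.filter fun i => truncEigenvalues V B i < beta0 mu :=
      Finset.monotone_filter_right _ fun i _ hi => lt_trans hi hβ
    -- The smallest of the three nested sets has at least `numNeg mu` elements and the largest at
    -- most that many, so all three are equal.
    have hc1 := Finset.card_le_card hs1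
    have hc2 := Finset.card_le_card hs2
    have he1 := Finset.eq_of_subset_of_card_le hs1 (by omega)
    have he2 := Finset.eq_of_subset_of_card_le hs2 (by omega)
    refine ⟨?_, fun i hi => ?_, fun i hi => ?_⟩
    · have hset : {i | truncEigenvalues V B i < 0}
          = ((Finset.univ.filter fun i => truncEigenvalues V B i < 0 : Finset _) : Set _) := by
        ext i; simp
      rw [hset, Set.ncard_coe_finset]
      omega
    · have : i ∈ Finset.univ.filter fun i => truncEigenvalues V B i < 0 := by simpa using hi
      rw [← he1] at this
      exact (Finset.mem_filter.mp this).2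
    · by_contra hlt
      have : i ∈ Finset.univ.filter fun i => truncEigenvalues V B i < beta0 mu := by
        simpa using hlt
      rw [← he2] at this
      exact hi (Finset.mem_filter.mp this).2
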